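/- Let $s>1$ and let $(a_n)_{n\ge 0}$ be a greedy $s$-energy sequence on the unit circle $S^1\subset\mathbb C$, i.e. $a_0\in S^1$ is arbitrary and for every $n\ge 0$ the point $a_{n+1}\in S^1$ satisfies $$\sum_{i=0}^{n}\frac1{|a_{n+1}-a_i|^s}=\inf_{z\in S^1}\sum_{i=0}^{n}\frac1{|z-a_i|^s}$$ (where $1/0=+\infty$). For $N\ge 1$ let $\alpha_N=(a_0,\dots,a_{N-1})$ and $E_s(\alpha_N)=\sum_{0\le i\ne j\le N-1}|a_i-a_j|^{-s}$. For $p\ge 1$ let $\Theta_p\subset[0,1]^p$ be the set of all $(\theta_1,\dots,\theta_p)$ for which there is an infinite sequence $\mathcal N$ of integers $N=2^{n_1}+\dots+2^{n_p}$, $n_1>\dots>n_p\ge 0$, with $\lim_{N\in\mathcal N}2^{n_i}/N=\theta_i$ for all $i=1,\dots,p$, and put $$H((\theta_1,\dots,\theta_p);s)=\sum_{k=1}^p\theta_k^s\Big(2(2^s-1)\sum_{j=k+1}^p\theta_j+\theta_k\Big),\qquad \overline h(s)=\sup_{p\ge 1}\ \sup_{\vec\theta\in\Theta_p}H(\vec\theta;s).$$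 Then, with $\zeta$ the Riemann zeta function, $$\limsup_{N\to\infty}\frac{E_s(\alpha_N)}{N^{1+s}}=\overline h(s)\,\frac{2\zeta(s)}{(2\pi)^s},\qquad \liminf_{N\to\infty}\frac{E_s(\alpha_N)}{N^{1+s}}=\frac{2\zeta(s)}{(2\pi)^s}.$$ Moreover $1<\overline h(s)<\infty$, and in particular the sequence $E_s(\alpha_N)/N^{1+s}$ does not converge. -/

import Mathlib

open Filter Topology
open scoped ENNReal

namespace GreedyRiesz

/-- The Riesz `s`-kernel `1 / |x - y| ^ s` on the unit circle, where `|x - y|` is the Euclidean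
distance in `ℂ`. It takes the value `∞` on the diagonal (for `s > 0`). -/
noncomputable def kernel (s : ℝ) (x y : Circle) : ℝ≥0∞ :=
  1 / ‖(x : ℂ) - (y : ℂ)‖ₑ ^ s

/-- `a` is a greedy `s`-energy sequence on the unit circle: `a 0` is arbitrary, and each `a (n + 1)`
minimizes over the circle the potential generated by `a 0, …, a n`. -/
def IsGreedy (s : ℝ) (a : ℕ → Circle) : Prop :=
  ∀ n : ℕ, ∑ i ∈ Finset.range (n + 1), kernel s (a (n + 1)) (a i) =
    ⨅ z : Circle, ∑ i ∈ Finset.range (n + 1), kernel s z (a i)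

/-- The Riesz `s`-energy of the first `N` points `a 0, …, a (N - 1)`: the sum of the kernel over all
ordered pairs of distinct indices. -/
noncomputable def energy (s : ℝ) (a : ℕ → Circle) (N : ℕ) : ℝ≥0∞ :=
  ∑ q ∈ (Finset.range N).offDiag, kernel s (a q.1) (a q.2)

/-- The set of vectors `θ` of length `p` for which there is an infinite (increasing) sequence of
integers `N = 2 ^ n₁ + ⋯ + 2 ^ n_p` with `n₁ > ⋯ > n_p ≥ 0`, along which `2 ^ n_i / N → θ_i` for
every `i`. Here `n m` lists the exponents of the `m`-th integer of that sequence. -/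
def Theta (p : ℕ) : Set (Fin p → ℝ) :=
  {θ | ∃ n : ℕ → Fin p → ℕ,
    (∀ m, StrictAnti (n m)) ∧
    StrictMono (fun m => ∑ i, 2 ^ n m i) ∧
    ∀ i, Tendsto (fun m => (2 : ℝ) ^ n m i / ((∑ j, 2 ^ n m j : ℕ) : ℝ)) atTop (𝓝 (θ i))}

/-- `H(θ; s) = ∑_k θ_k ^ s * (2 (2 ^ s - 1) ∑_{j > k} θ_j + θ_k)`. -/
noncomputable def H {p : ℕ} (θ : Fin p → ℝ) (s : ℝ) : ℝ :=
  ∑ k, θ k ^ s * (2 * ((2 : ℝ) ^ s - 1) * (∑ j ∈ Finset.Ioi k, θ j) + θ k)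

/-- The supremum of `H(θ; s)` over the vectors `θ` in `Theta p`, as an extended real number. -/
noncomputable def hUpperAt (p : ℕ) (s : ℝ) : EReal :=
  ⨆ θ ∈ Theta p, (H θ s : EReal)

/-- The supremum over all `p ≥ 1` of `hUpperAt p s`. -/
noncomputable def hUpper (s : ℝ) : EReal :=
  ⨆ p : ℕ, ⨆ _ : 1 ≤ p, hUpperAt p s

/-- The normalized energy `E_s(α_N) / N ^ (1 + s)`, as an extended real number. -/
noncomputable def normalizedEnergy (s : ℝ) (a : ℕ → Circle) (N : ℕ) : EReal :=
  ((energy s a N / (N : ℝ≥0∞) ^ (1 + s) : ℝ≥0∞) : EReal)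

end GreedyRiesz

namespace GreedyRiesz

/-! The potential of `M` equally spaced points is smallest exactly at the midpoints of the arcs
between them. By induction on `m`, the first `2 ^ m` greedy points therefore form a coset of the `2
^ m`-th roots of unity. The following points, up to `2 ^ m` of them, lie on the midpoint coset and
are themselves a greedy sequence (`RootStructure.tail`): some minimizer of their own potential lies
on that coset, where the potential of the first block is minimal too, so the next greedy point must
minimize both.

Hence the potential at the `n`-th point is the sum of `midPot s (2 ^ m)` over the binary digits of
`n` (`pot_greedy`), and the energy does not depend on the greedy choices. Since `midPot s M =
rootPot s (2 * M) - rootPot s M`, and `rootPot s M` grows like `C * M ^ s` along even `M`, with `C =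
2ζ(s) / (2π) ^ s`, the digit weights are asymptotic to `C * (2 ^ s - 1) * (2 ^ m) ^ s`. Replacing
them by this leading term costs `o(N ^ (1 + s))` (`tendsto_energy_sub`).

For `N = ∑ 2 ^ n i` the leading energy is `H` at the vector of powers `2 ^ n i`. By homogeneity, its
quotient by `N ^ (1 + s)` is `H` at the proportions `2 ^ n i / N`. Multiplying `N` by powers of two
preserves these proportions, so each value of the quotient is attained on `Theta`; conversely `H` on
`Theta` is a limit of such values. This gives the limsup. Convexity of `(1 + t) ^ (1 + s) - t ^ (1 +
s)` bounds the quotient below by `1`, with equality at powers of two and strict inequality at `N =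
3`. This gives the liminf and the divergence. -/

/-! ### The Riesz kernel on the circle, in half-angles. -/

theorem norm_exp_sub_one (x : ℝ) : ‖((Circle.exp (2 * x) : Circle) : ℂ) - 1‖ = 2 * |Real.sin x| := by
  have h := Complex.norm_exp_I_mul_ofReal_sub_one (2 * x)
  rw [Circle.coe_exp, mul_comm ((2 * x : ℝ) : ℂ), h, norm_mul]
  simp

theorem norm_mul_exp_sub (y : Circle) (x x' : ℝ) :
    ‖((y * Circle.exp (2 * x) : Circle) : ℂ) - ((y * Circle.exp (2 * x') : Circle) : ℂ)‖
      = 2 * |Real.sin (x - x')| := by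
  have : ((y * Circle.exp (2 * x) : Circle) : ℂ) - ((y * Circle.exp (2 * x') : Circle) : ℂ)
      = ((y * Circle.exp (2 * x') : Circle) : ℂ) * (((Circle.exp (2 * (x - x')) : Circle) : ℂ) - 1) := by
    have e : (2 * x : ℝ) = 2 * x' + 2 * (x - x') := by ring
    rw [e, Circle.exp_add]
    push_cast
    ring
  rw [this, norm_mul, Circle.norm_coe, one_mul, norm_exp_sub_one]

theorem kernel_self {s : ℝ} (hs : 0 < s) (z : Circle) : kernel s z z = ⊤ := by
  simp [kernel, hs]

theorem kernel_eq_ofReal (s : ℝ) {z w : Circle} (h : z ≠ w) :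
    kernel s z w = ENNReal.ofReal (‖(z : ℂ) - w‖ ^ (-s)) := by
  have hp : 0 < ‖(z : ℂ) - w‖ := by
    rw [norm_pos_iff, sub_ne_zero]
    exact fun e => h (Circle.ext e)
  rw [kernel, ← ofReal_norm, ENNReal.ofReal_rpow_of_pos hp, one_div,
    ← ENNReal.ofReal_inv_of_pos (by positivity), Real.rpow_neg hp.le]

theorem kernel_ne_top (s : ℝ) {z w : Circle} (h : z ≠ w) : kernel s z w ≠ ⊤ := by
  rw [kernel_eq_ofReal s h]
  exact ENNReal.ofReal_ne_top

theorem kernel_comm (s : ℝ) (z w : Circle) : kernel s z w = kernel s w z := by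
  rw [kernel, kernel, ← ofReal_norm, ← ofReal_norm, norm_sub_rev]

theorem continuous_kernel (s : ℝ) (w : Circle) : Continuous fun z => kernel s z w := by
  unfold kernel
  simp only [one_div]
  fun_prop

/-! ### Cosets of the `M`-th roots of unity. -/

open Classical in
/-- The `M` points of the circle with the same `M`-th power as `y`. -/
noncomputable def rootSet (M : ℕ) (y : Circle) : Finset Circle :=
  (Finset.range M).image fun k : ℕ => y * Circle.exp (2 * -(Real.pi * k / M))

theorem exp_pow_two_pi_div {M : ℕ} (hM : M ≠ 0) (k : ℕ) :
    Circle.exp (2 * -(Real.pi * k / M)) ^ M = 1 := by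
  rw [← Circle.exp_nsmul]
  have : M • (2 * -(Real.pi * k / M)) = ((-k : ℤ) : ℝ) * (2 * Real.pi) := by
    have : (M : ℝ) ≠ 0 := by exact_mod_cast hM
    rw [nsmul_eq_mul]
    push_cast
    field_simp
  rw [this, Circle.exp_int_mul_two_pi]

theorem exp_inj_on_range {M : ℕ} (hM : M ≠ 0) (y : Circle) :
    Set.InjOn (fun k : ℕ => y * Circle.exp (2 * -(Real.pi * k / M))) (Finset.range M) := by
  intro i hi j hj h
  have hi' : i < M := by simpa using hi
  have hj' : j < M := by simpa using hj
  have hM' : (0 : ℝ) < M := by exact_mod_cast Nat.pos_of_ne_zero hM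
  have h0 : Circle.exp (2 * -(Real.pi * i / M)) = Circle.exp (2 * -(Real.pi * j / M)) :=
    mul_left_cancel h
  obtain ⟨m, hm⟩ := Circle.exp_eq_exp.1 h0
  have h1 : (j : ℝ) = i + m * M := by
    have := Real.pi_pos
    field_simp at hm
    nlinarith
  have h2 : (j : ℤ) = i + m * M := by exact_mod_cast h1
  have : m = 0 := by
    by_contra hne
    rcases lt_or_gt_of_ne hne with hlt | hgt
    · nlinarith
    · nlinarith
  subst this
  omega

open Classical in
theorem card_rootSet {M : ℕ} (hM : M ≠ 0) (y : Circle) : (rootSet M y).card = M := by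
  rw [rootSet, Finset.card_image_of_injOn (exp_inj_on_range hM y), Finset.card_range]

-- Counting gives the hard direction: the `M` distinct points of `rootSet` are roots of a polynomial
-- of degree `M`, so they exhaust its roots.
open Classical in
theorem mem_rootSet {M : ℕ} (hM : M ≠ 0) {y w : Circle} : w ∈ rootSet M y ↔ w ^ M = y ^ M := by
  constructor
  · intro h
    obtain ⟨k, -, rfl⟩ := Finset.mem_image.1 h
    rw [mul_pow, exp_pow_two_pi_div hM, mul_one]
  · intro h
    have hsub : (rootSet M y).image (fun z : Circle => (z : ℂ)) ⊆
        (Polynomial.nthRoots M ((y : ℂ) ^ M)).toFinset := by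
      intro z hz
      obtain ⟨u, hu, rfl⟩ := Finset.mem_image.1 hz
      obtain ⟨k, -, rfl⟩ := Finset.mem_image.1 hu
      rw [Multiset.mem_toFinset, Polynomial.mem_nthRoots (Nat.pos_of_ne_zero hM)]
      rw [← Circle.coe_pow, mul_pow, exp_pow_two_pi_div hM, mul_one, Circle.coe_pow]
    have hinj : Function.Injective (fun z : Circle => (z : ℂ)) := fun a b h => Circle.ext h
    have heq := Finset.eq_of_subset_of_card_le hsub (by
      rw [Finset.card_image_of_injective _ hinj, card_rootSet hM]
      exact (Multiset.toFinset_card_le _).trans (Polynomial.card_nthRoots _ _))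
    have hw : (w : ℂ) ∈ (Polynomial.nthRoots M ((y : ℂ) ^ M)).toFinset := by
      rw [Multiset.mem_toFinset, Polynomial.mem_nthRoots (Nat.pos_of_ne_zero hM),
        ← Circle.coe_pow, h, Circle.coe_pow]
    rw [← heq] at hw
    obtain ⟨u, hu, e⟩ := Finset.mem_image.1 hw
    rwa [← hinj e]

theorem rootSet_congr {M : ℕ} (hM : M ≠ 0) {y y' : Circle} (h : y' ^ M = y ^ M) :
    rootSet M y' = rootSet M y := by
  ext w
  rw [mem_rootSet hM, mem_rootSet hM, h]

/-! ### Equally spaced points: the potential is minimal exactly at midpoints. -/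

/-- The potential of `M` equally spaced points, at half-angle `x` from one of them. -/
noncomputable def equiPot (s : ℝ) (M : ℕ) (x : ℝ) : ℝ :=
  ∑ k ∈ Finset.range M, (2 * Real.sin (x + Real.pi * k / M)) ^ (-s)

theorem angle_mem_Ioo {M k : ℕ} (hk : k < M) {x : ℝ} (h0 : 0 < x) (h1 : x < Real.pi / M) :
    x + Real.pi * k / M ∈ Set.Ioo 0 Real.pi := by
  have hM' : (0 : ℝ) < M := by exact_mod_cast (by omega : 0 < M)
  have hk' : (k : ℝ) + 1 ≤ M := by exact_mod_cast hk
  have := Real.pi_pos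
  refine ⟨by positivity, ?_⟩
  calc x + Real.pi * k / M < Real.pi / M + Real.pi * k / M := by linarith
    _ = Real.pi * (k + 1) / M := by ring
    _ ≤ Real.pi := by
      rw [div_le_iff₀ hM']
      nlinarith

open Classical in
theorem sum_kernel_rootSet (s : ℝ) {M : ℕ} (hM : M ≠ 0) (y : Circle) {x : ℝ}
    (h0 : 0 < x) (h1 : x < Real.pi / M) :
    ∑ w ∈ rootSet M y, kernel s (y * Circle.exp (2 * x)) w = ENNReal.ofReal (equiPot s M x) := by
  have hpos : ∀ k ∈ Finset.range M, 0 < Real.sin (x + Real.pi * k / M) := fun k hk =>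
    Real.sin_pos_of_mem_Ioo (angle_mem_Ioo (Finset.mem_range.1 hk) h0 h1)
  rw [rootSet, Finset.sum_image (exp_inj_on_range hM y), equiPot, ENNReal.ofReal_sum_of_nonneg]
  · refine Finset.sum_congr rfl fun k hk => ?_
    have hp := hpos k hk
    have hn := norm_mul_exp_sub y x (-(Real.pi * k / M))
    rw [sub_neg_eq_add, abs_of_pos hp] at hn
    rw [kernel_eq_ofReal s, hn]
    intro e
    rw [e, sub_self, norm_zero] at hn
    linarith
  · intro k hk
    have hp := hpos k hk
    positivity

/-- Rotating the base point by a multiple of `2π / M` leaves the coset unchanged, so any `z` can be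
viewed from the coset point just before it. It then suffices to study `equiPot` on a single arc. -/
theorem exists_rootSet_exp {M : ℕ} (hM : M ≠ 0) (y z : Circle) :
    ∃ y' : Circle, y' ^ M = y ^ M ∧ ∃ x : ℝ, 0 ≤ x ∧ x < Real.pi / M ∧
      z = y' * Circle.exp (2 * x) := by
  obtain ⟨t, ht⟩ : ∃ t : ℝ, Circle.exp t = z / y := Circle.exp_surjective _
  have hM' : (0 : ℝ) < M := by exact_mod_cast Nat.pos_of_ne_zero hM
  have hd : 0 < Real.pi / M := div_pos Real.pi_pos hM'
  set q := ⌊(t / 2) / (Real.pi / M)⌋ with hq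
  have e1 := Int.floor_le ((t / 2) / (Real.pi / M))
  have e2 := Int.lt_floor_add_one ((t / 2) / (Real.pi / M))
  rw [← hq, le_div_iff₀ hd] at e1
  rw [← hq, div_lt_iff₀ hd] at e2
  refine ⟨y * Circle.exp (2 * (q * (Real.pi / M))), ?_, t / 2 - q * (Real.pi / M), by linarith,
    by linarith, ?_⟩
  · rw [mul_pow, ← Circle.exp_nsmul, nsmul_eq_mul]
    have : (M : ℝ) * (2 * (q * (Real.pi / M))) = q * (2 * Real.pi) := by
      field_simp
    rw [this, Circle.exp_int_mul_two_pi, mul_one]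
  · rw [mul_assoc, ← Circle.exp_add]
    have : 2 * (q * (Real.pi / M)) + 2 * (t / 2 - q * (Real.pi / M)) = t := by ring
    rw [this, ht, mul_div_cancel]

/-- The arithmetic-geometric mean inequality for `a ^ (-s)` and `b ^ (-s)`, followed by `(a * b) ^
(-s) ≥ (c ^ 2) ^ (-s)`. -/
theorem two_mul_rpow_neg_le {s a b c : ℝ} (hs : 0 < s) (ha : 0 < a) (hb : 0 < b) (hc : 0 < c)
    (h : a * b ≤ c ^ 2) : 2 * c ^ (-s) ≤ a ^ (-s) + b ^ (-s) := by
  have h1 : (c ^ 2) ^ (-s) ≤ (a * b) ^ (-s) :=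
    Real.rpow_le_rpow_of_nonpos (by positivity) h (by linarith)
  rw [Real.mul_rpow ha.le hb.le, pow_two, Real.mul_rpow hc.le hc.le] at h1
  have := Real.rpow_pos_of_pos ha (-s)
  have := Real.rpow_pos_of_pos hb (-s)
  have := Real.rpow_pos_of_pos hc (-s)
  nlinarith [sq_nonneg (a ^ (-s) - b ^ (-s))]

theorem two_mul_rpow_neg_lt {s a b c : ℝ} (hs : 0 < s) (ha : 0 < a) (hb : 0 < b) (hc : 0 < c)
    (h : a * b < c ^ 2) : 2 * c ^ (-s) < a ^ (-s) + b ^ (-s) := by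
  have h1 : (c ^ 2) ^ (-s) < (a * b) ^ (-s) :=
    Real.rpow_lt_rpow_of_neg (by positivity) h (by linarith)
  rw [Real.mul_rpow ha.le hb.le, pow_two, Real.mul_rpow hc.le hc.le] at h1
  have := Real.rpow_pos_of_pos ha (-s)
  have := Real.rpow_pos_of_pos hb (-s)
  have := Real.rpow_pos_of_pos hc (-s)
  nlinarith [sq_nonneg (a ^ (-s) - b ^ (-s))]

theorem sin_mul_sin_eq (c d : ℝ) :
    Real.sin (c + d) * Real.sin (c - d) = Real.sin c ^ 2 - Real.sin d ^ 2 := by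
  rw [Real.sin_add, Real.sin_sub]
  have h1 := Real.sin_sq_add_cos_sq c
  have h2 := Real.sin_sq_add_cos_sq d
  linear_combination Real.sin c ^ 2 * h2 - Real.sin d ^ 2 * h1

theorem equiPot_reflect (s : ℝ) {M : ℕ} (hM : M ≠ 0) (x : ℝ) :
    equiPot s M (Real.pi / M - x) = equiPot s M x := by
  have hM' : (M : ℝ) ≠ 0 := by exact_mod_cast hM
  rw [equiPot, equiPot, ← Finset.sum_range_reflect]
  refine Finset.sum_congr rfl fun k hk => ?_
  have hk' : k + 1 ≤ M := Finset.mem_range.1 hk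
  have e : ((M - 1 - k : ℕ) : ℝ) = M - 1 - k := by
    rw [Nat.sub_sub, Nat.cast_sub (by omega)]
    push_cast
    ring
  rw [e, ← Real.sin_pi_sub]
  congr 3
  field_simp
  ring

/-- The angles to the `k`-th point from `x` and from its mirror image are `c + d` and `c - d`, where
`c` is the angle from the midpoint. The bound on `|d|` makes `sin d` vanish only at the midpoint. -/
theorem equiPot_pair {M k : ℕ} (hk : k < M) {x : ℝ}
    (h0 : 0 < x) (h1 : x < Real.pi / M) :
    ∃ c d : ℝ, c = Real.pi / (2 * M) + Real.pi * k / M ∧ d = x - Real.pi / (2 * M) ∧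
      x + Real.pi * k / M = c + d ∧ Real.pi / M - x + Real.pi * k / M = c - d ∧
      0 < Real.sin (c + d) ∧ 0 < Real.sin (c - d) ∧ 0 < Real.sin c ∧
      |d| < Real.pi := by
  have hM1 : (1 : ℝ) ≤ M := by exact_mod_cast (by omega : 1 ≤ M)
  have hh : Real.pi / M = 2 * (Real.pi / (2 * M)) := by field_simp
  have hpi : Real.pi / M ≤ Real.pi := div_le_self Real.pi_pos.le hM1
  have hx2 : 0 < Real.pi / M := div_pos Real.pi_pos (by linarith)
  have a1 := Real.sin_pos_of_mem_Ioo (angle_mem_Ioo hk h0 h1)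
  have a2 := Real.sin_pos_of_mem_Ioo (angle_mem_Ioo (x := Real.pi / M - x) hk (by linarith) (by linarith))
  have a3 := Real.sin_pos_of_mem_Ioo
    (angle_mem_Ioo (x := Real.pi / (2 * M)) hk (by linarith) (by linarith))
  have e1 : x + Real.pi * k / M
      = (Real.pi / (2 * M) + Real.pi * k / M) + (x - Real.pi / (2 * M)) := by ring
  have e2 : Real.pi / M - x + Real.pi * k / M
      = (Real.pi / (2 * M) + Real.pi * k / M) - (x - Real.pi / (2 * M)) := by
    rw [hh]; ring
  refine ⟨_, _, rfl, rfl, e1, e2, e1 ▸ a1, e2 ▸ a2, a3, ?_⟩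
  rw [abs_lt]
  constructor <;> linarith

/-- Averaging over the reflection of the arc reduces the claim to single terms, where `sin (c + d) *
sin (c - d) = sin c ^ 2 - sin d ^ 2 ≤ sin c ^ 2`. -/
theorem equiPot_mid_le {s : ℝ} (hs : 0 < s) {M : ℕ} (hM : M ≠ 0) {x : ℝ}
    (h0 : 0 < x) (h1 : x < Real.pi / M) : equiPot s M (Real.pi / (2 * M)) ≤ equiPot s M x := by
  have h : 2 * equiPot s M (Real.pi / (2 * M)) ≤ equiPot s M x + equiPot s M (Real.pi / M - x) := by
    rw [equiPot, equiPot, equiPot, ← Finset.sum_add_distrib, Finset.mul_sum]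
    refine Finset.sum_le_sum fun k hk => ?_
    obtain ⟨c, d, hc, hd, e1, e2, p1, p2, p3, -⟩ := equiPot_pair (Finset.mem_range.1 hk) h0 h1
    rw [e1, e2, ← hc]
    refine two_mul_rpow_neg_le hs (by positivity) (by positivity) (by positivity) ?_
    nlinarith [sin_mul_sin_eq c d, sq_nonneg (Real.sin d)]
  rw [equiPot_reflect s hM] at h
  linarith

theorem equiPot_mid_lt {s : ℝ} (hs : 0 < s) {M : ℕ} (hM : M ≠ 0) {x : ℝ}
    (h0 : 0 < x) (h1 : x < Real.pi / M) (hx : x ≠ Real.pi / (2 * M)) :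
    equiPot s M (Real.pi / (2 * M)) < equiPot s M x := by
  have h : 2 * equiPot s M (Real.pi / (2 * M)) < equiPot s M x + equiPot s M (Real.pi / M - x) := by
    rw [equiPot, equiPot, equiPot, ← Finset.sum_add_distrib, Finset.mul_sum]
    refine Finset.sum_lt_sum_of_nonempty (Finset.nonempty_range_iff.2 hM) fun k hk => ?_
    obtain ⟨c, d, hc, hd, e1, e2, p1, p2, p3, p4⟩ :=
      equiPot_pair (Finset.mem_range.1 hk) h0 h1
    rw [e1, e2, ← hc]
    refine two_mul_rpow_neg_lt hs (by positivity) (by positivity) (by positivity) ?_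
    have hd0 : Real.sin d ≠ 0 := by
      rw [Ne, Real.sin_eq_zero_iff_of_lt_of_lt (abs_lt.1 p4).1 (abs_lt.1 p4).2, hd]
      exact sub_ne_zero.2 hx
    nlinarith [sin_mul_sin_eq c d, sq_pos_of_ne_zero hd0]
  rw [equiPot_reflect s hM] at h
  linarith

/-- The smallest value of the potential of `M` equally spaced points. -/
noncomputable def midPot (s : ℝ) (M : ℕ) : ℝ := equiPot s M (Real.pi / (2 * M))

theorem pi_div_two_mul_pos {M : ℕ} (hM : M ≠ 0) : 0 < Real.pi / (2 * M) := by
  have hM' : (0 : ℝ) < M := by exact_mod_cast Nat.pos_of_ne_zero hM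
  exact div_pos Real.pi_pos (by linarith)

theorem pi_div_two_mul_lt {M : ℕ} (hM : M ≠ 0) : Real.pi / (2 * M) < Real.pi / M := by
  have := pi_div_two_mul_pos hM
  have hM' : (0 : ℝ) < M := by exact_mod_cast Nat.pos_of_ne_zero hM
  have hh : Real.pi / M = 2 * (Real.pi / (2 * M)) := by field_simp
  linarith

theorem sum_kernel_mid (s : ℝ) {M : ℕ} (hM : M ≠ 0) {y z : Circle}
    (hz : z ∈ rootSet M (y * Circle.exp (2 * (Real.pi / (2 * M))))) :
    ∑ w ∈ rootSet M y, kernel s z w = ENNReal.ofReal (midPot s M) := by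
  rw [mem_rootSet hM, mul_pow] at hz
  have hy : (z * (Circle.exp (2 * (Real.pi / (2 * M))))⁻¹) ^ M = y ^ M := by
    rw [mul_pow, hz, inv_pow, mul_inv_cancel_right]
  rw [← rootSet_congr hM hy]
  have := sum_kernel_rootSet s hM (z * (Circle.exp (2 * (Real.pi / (2 * M))))⁻¹)
    (pi_div_two_mul_pos hM) (pi_div_two_mul_lt hM)
  rwa [inv_mul_cancel_right] at this

theorem midPot_le_sum_kernel {s : ℝ} (hs : 0 < s) {M : ℕ} (hM : M ≠ 0) (y z : Circle) :
    ENNReal.ofReal (midPot s M) ≤ ∑ w ∈ rootSet M y, kernel s z w := by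
  obtain ⟨y', hy, x, h0, h1, rfl⟩ := exists_rootSet_exp hM y z
  rw [← rootSet_congr hM hy]
  rcases h0.eq_or_lt with rfl | h0
  · have : kernel s (y' * Circle.exp (2 * 0)) y' = ⊤ := by
      simp [kernel_self hs]
    rw [ENNReal.sum_eq_top.2 ⟨y', (mem_rootSet hM).2 rfl, this⟩]
    exact le_top
  · rw [sum_kernel_rootSet s hM y' h0 h1]
    exact ENNReal.ofReal_le_ofReal (equiPot_mid_le hs hM h0 h1)

theorem equiPot_nonneg (s : ℝ) {M : ℕ} {x : ℝ} (h0 : 0 < x)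
    (h1 : x < Real.pi / M) : 0 ≤ equiPot s M x := by
  refine Finset.sum_nonneg fun k hk => ?_
  have := Real.sin_pos_of_mem_Ioo (angle_mem_Ioo (Finset.mem_range.1 hk) h0 h1)
  positivity

theorem mem_rootSet_of_sum_kernel_le {s : ℝ} (hs : 0 < s) {M : ℕ} (hM : M ≠ 0) {y z : Circle}
    (h : ∑ w ∈ rootSet M y, kernel s z w ≤ ENNReal.ofReal (midPot s M)) :
    z ∈ rootSet M (y * Circle.exp (2 * (Real.pi / (2 * M)))) := by
  obtain ⟨y', hy, x, h0, h1, rfl⟩ := exists_rootSet_exp hM y z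
  rw [← rootSet_congr hM hy] at h
  rcases h0.eq_or_lt with rfl | h0
  · have : kernel s (y' * Circle.exp (2 * 0)) y' = ⊤ := by
      simp [kernel_self hs]
    rw [ENNReal.sum_eq_top.2 ⟨y', (mem_rootSet hM).2 rfl, this⟩] at h
    exact absurd (top_le_iff.1 h) ENNReal.ofReal_ne_top
  · rw [sum_kernel_rootSet s hM y' h0 h1, midPot, ENNReal.ofReal_le_ofReal_iff (equiPot_nonneg s
      (pi_div_two_mul_pos hM) (pi_div_two_mul_lt hM))] at h
    have hx : x = Real.pi / (2 * M) := by
      by_contra hne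
      exact absurd (equiPot_mid_lt hs hM h0 h1 hne) (not_lt.2 h)
    rw [mem_rootSet hM, mul_pow, mul_pow, hy, hx]

/-! ### Structure of greedy sequences. -/

/-- The potential at `z` of the points `b 0, …, b (n - 1)`. -/
noncomputable def pot (s : ℝ) (b : ℕ → Circle) (n : ℕ) (z : Circle) : ℝ≥0∞ :=
  ∑ i ∈ Finset.range n, kernel s z (b i)

/-- The greedy condition for the first `n` points of `b`. -/
def GreedyUpTo (s : ℝ) (n : ℕ) (b : ℕ → Circle) : Prop :=
  ∀ k < n, ∀ z, pot s b k (b k) ≤ pot s b k z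

theorem IsGreedy.greedyUpTo {s : ℝ} {a : ℕ → Circle} (ha : IsGreedy s a) (n : ℕ) :
    GreedyUpTo s n a := by
  intro k _ z
  cases k with
  | zero => simp [pot]
  | succ k =>
    rw [pot, ha k]
    exact iInf_le _ z

theorem GreedyUpTo.mono {s : ℝ} {m n : ℕ} {b : ℕ → Circle} (h : GreedyUpTo s n b) (hmn : m ≤ n) :
    GreedyUpTo s m b :=
  fun k hk => h k (hk.trans_le hmn)

theorem pot_congr {s : ℝ} {b c : ℕ → Circle} {n : ℕ} (h : ∀ i < n, b i = c i) (z : Circle) :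
    pot s b n z = pot s c n z :=
  Finset.sum_congr rfl fun i hi => by rw [h i (Finset.mem_range.1 hi)]

theorem continuous_pot (s : ℝ) (b : ℕ → Circle) (n : ℕ) : Continuous (pot s b n) :=
  continuous_finsetSum _ fun _ _ => continuous_kernel s _

theorem exists_forall_pot_le (s : ℝ) (b : ℕ → Circle) (n : ℕ) :
    ∃ w, ∀ z, pot s b n w ≤ pot s b n z := by
  obtain ⟨w, -, hw⟩ := isCompact_univ.exists_isMinOn (Set.univ_nonempty (α := Circle))
    (continuous_pot s b n).continuousOn
  exact ⟨w, fun z => hw (Set.mem_univ z)⟩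

theorem infinite_circle : Infinite Circle :=
  Infinite.of_injective (fun k : ℕ => Circle.exp (1 / (k + 1 : ℝ))) fun i j h => by
    have hb : ∀ k : ℕ, 1 / (k + 1 : ℝ) ∈ Set.Ioc (-Real.pi) Real.pi := fun k => by
      have h1 : 0 < 1 / (k + 1 : ℝ) := by positivity
      have h2 : 1 / (k + 1 : ℝ) ≤ 1 := by
        rw [div_le_one (by positivity)]
        linarith [(Nat.cast_nonneg k : (0 : ℝ) ≤ k)]
      have := Real.pi_gt_three
      constructor <;> linarith
    have := congrArg (fun z : Circle => Complex.arg z) h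
    simp only [Circle.arg_exp (hb _).1 (hb _).2] at this
    field_simp at this
    exact_mod_cast (add_right_cancel this).symm

-- The circle is infinite, so some point avoids the configuration and has finite potential. This
-- finiteness permits cancellation in `ℝ≥0∞` and rules out repeated greedy points.
open Classical in
theorem pot_ne_top_of_forall_le {s : ℝ} {b : ℕ → Circle} {n : ℕ} {w : Circle}
    (h : ∀ z, pot s b n w ≤ pot s b n z) : pot s b n w ≠ ⊤ := by
  have := infinite_circle
  obtain ⟨z, hz⟩ := Infinite.exists_notMem_finset ((Finset.range n).image b)
  refine ((h z).trans_lt ?_).ne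
  rw [pot, ENNReal.sum_lt_top]
  intro i hi
  refine (kernel_ne_top s ?_).lt_top
  rintro rfl
  exact hz (Finset.mem_image_of_mem _ hi)

theorem GreedyUpTo.injOn {s : ℝ} (hs : 0 < s) {n : ℕ} {b : ℕ → Circle} (h : GreedyUpTo s n b) :
    Set.InjOn b (Finset.range n) := by
  have key : ∀ i j, i < j → j < n → b i ≠ b j := by
    intro i j hij hj e
    refine pot_ne_top_of_forall_le (h j hj) (ENNReal.sum_eq_top.2 ⟨i, Finset.mem_range.2 hij, ?_⟩)
    rw [e, kernel_self hs]
  intro i hi j hj e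
  have hi' : i < n := by simpa using hi
  have hj' : j < n := by simpa using hj
  rcases lt_trichotomy i j with hlt | heq | hgt
  · exact absurd e (key i j hlt hj')
  · exact heq
  · exact absurd e.symm (key j i hgt hi')

open Classical in
theorem pot_eq_sum_rootSet {s : ℝ} (hs : 0 < s) {M : ℕ} (hM : M ≠ 0) {b : ℕ → Circle}
    (h : GreedyUpTo s M b) (hb : ∀ i < M, b i ^ M = b 0 ^ M) (z : Circle) :
    pot s b M z = ∑ w ∈ rootSet M (b 0), kernel s z w := by
  have himg : (Finset.range M).image b = rootSet M (b 0) := by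
    refine Finset.eq_of_subset_of_card_le ?_ ?_
    · intro w hw
      obtain ⟨i, hi, rfl⟩ := Finset.mem_image.1 hw
      exact (mem_rootSet hM).2 (hb i (Finset.mem_range.1 hi))
    · rw [card_rootSet hM, Finset.card_image_of_injOn (h.injOn hs), Finset.card_range]
  rw [← himg, Finset.sum_image (h.injOn hs), pot]

theorem pot_add (s : ℝ) (b : ℕ → Circle) (M r : ℕ) (z : Circle) :
    pot s b (M + r) z = pot s b M z + pot s (fun i => b (M + i)) r z :=
  Finset.sum_range_add _ _ _

/-- Every greedy sequence of at most `M` points lies in one coset of the `M`-th roots of unity. -/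
def RootStructure (s : ℝ) (M : ℕ) : Prop :=
  ∀ n ≤ M, ∀ b : ℕ → Circle, GreedyUpTo s n b → ∀ i < n, b i ^ M = b 0 ^ M

/-- The total potential is that of the full coset plus that of the tail. A point `w` of the midpoint
coset minimizes both summands, so the next greedy point has to minimize each of them separately. -/
theorem RootStructure.tail {s : ℝ} (hs : 0 < s) {M : ℕ} (hM : M ≠ 0) (hP : RootStructure s M)
    {b : ℕ → Circle} : ∀ {j : ℕ}, j ≤ M → GreedyUpTo s (M + j) b →
    GreedyUpTo s j (fun i => b (M + i)) ∧
      ∀ i < j, b (M + i) ∈ rootSet M (b 0 * Circle.exp (2 * (Real.pi / (2 * M)))) := by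
  intro j
  induction j with
  | zero => exact fun _ _ => ⟨fun k hk => absurd hk (Nat.not_lt_zero k),
      fun k hk => absurd hk (Nat.not_lt_zero k)⟩
  | succ j ih =>
    intro hj hb
    obtain ⟨h1, h2⟩ := ih (by omega) (hb.mono (by omega))
    set c : ℕ → Circle := fun i => b (M + i) with hc
    have hbM : GreedyUpTo s M b := hb.mono (by omega)
    have hV := pot_eq_sum_rootSet hs hM hbM (hP M le_rfl b hbM)
    obtain ⟨w, hwR, hw⟩ : ∃ w ∈ rootSet M (b 0 * Circle.exp (2 * (Real.pi / (2 * M)))),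
        ∀ z, pot s c j w ≤ pot s c j z := by
      rcases Nat.eq_zero_or_pos j with rfl | hj0
      · exact ⟨_, (mem_rootSet hM).2 rfl, fun z => by simp [pot]⟩
      · obtain ⟨w, hw⟩ := exists_forall_pot_le s c j
        refine ⟨w, ?_, hw⟩
        have hlt : ∀ k < j, Function.update c j w k = c k := fun k hk =>
          Function.update_of_ne hk.ne _ _
        -- Appending any minimizer `w` to the tail gives a greedy sequence of length `j + 1 ≤ M`, so
        -- `hP` places `w` in the coset of the tail's first point, which is the midpoint coset.
        have hg : GreedyUpTo s (j + 1) (Function.update c j w) := by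
          intro k hk z
          have hk' : ∀ i < k, Function.update c j w i = c i := fun i hi => hlt i (by omega)
          rw [pot_congr hk', pot_congr hk']
          rcases (Nat.lt_succ_iff.1 hk).lt_or_eq with hlt' | rfl
          · rw [hlt k hlt']
            exact h1 k hlt' z
          · rw [Function.update_self]
            exact hw z
        have := hP (j + 1) hj _ hg j (Nat.lt_succ_self j)
        rw [Function.update_self, hlt 0 hj0] at this
        rw [mem_rootSet hM, this, ← mem_rootSet hM]
        exact h2 0 hj0
    have hmin := hb (M + j) (by omega) w
    rw [pot_add, pot_add, hV, hV, sum_kernel_mid s hM hwR] at hmin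
    have hle := midPot_le_sum_kernel hs hM (b 0) (b (M + j)) (s := s)
    have hfin := pot_ne_top_of_forall_le hw
    -- Both summands at `w` are finite and minimal; cancelling each in turn shows that neither can
    -- be larger at `b (M + j)`.
    have hcj : pot s c j (b (M + j)) ≤ pot s c j w :=
      (ENNReal.add_le_add_iff_left ENNReal.ofReal_ne_top).1 ((add_le_add_left hle _).trans hmin)
    have hVj : ∑ w ∈ rootSet M (b 0), kernel s (b (M + j)) w ≤ ENNReal.ofReal (midPot s M) :=
      (ENNReal.add_le_add_iff_right hfin).1 ((add_le_add_right (hw _) _).trans hmin)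
    refine ⟨fun k hk z => ?_, fun i hi => ?_⟩
    · rcases (Nat.lt_succ_iff.1 hk).lt_or_eq with hlt' | rfl
      · exact h1 k hlt' z
      · exact hcj.trans (hw z)
    · rcases (Nat.lt_succ_iff.1 hi).lt_or_eq with hlt' | rfl
      · exact h2 i hlt'
      · exact mem_rootSet_of_sum_kernel_le hs hM hVj

theorem exp_mid_pow {M : ℕ} (hM : M ≠ 0) :
    (Circle.exp (2 * (Real.pi / (2 * M))) ^ M) ^ 2 = 1 := by
  have hM' : (M : ℝ) ≠ 0 := by exact_mod_cast hM
  rw [← pow_mul, ← Circle.exp_nsmul, nsmul_eq_mul]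
  have : ((M * 2 : ℕ) : ℝ) * (2 * (Real.pi / (2 * M))) = 2 * Real.pi := by
    push_cast
    field_simp
  rw [this, Circle.exp_two_pi]

/-- The midpoint rotation has `M`-th power of square one, so a coset and its midpoint coset agree
after taking `2 * M`-th powers. -/
theorem rootStructure_two_pow {s : ℝ} (hs : 0 < s) (m : ℕ) : RootStructure s (2 ^ m) := by
  induction m with
  | zero =>
    intro n hn b _ i hi
    have : i = 0 := by
      rw [pow_zero] at hn
      omega
    rw [this]
  | succ m ih =>
    intro n hn b hb i hi
    have hM : 2 ^ m ≠ 0 := by positivity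
    rw [pow_succ] at hn
    rw [pow_succ, pow_mul, pow_mul]
    rcases le_or_gt n (2 ^ m) with h | h
    · rw [ih n h b hb i hi]
    · rcases lt_or_ge i (2 ^ m) with hi' | hi'
      · rw [ih (2 ^ m) le_rfl b (hb.mono h.le) i hi']
      · obtain ⟨j, rfl⟩ := Nat.exists_eq_add_of_le h.le
        obtain ⟨k, rfl⟩ := Nat.exists_eq_add_of_le hi'
        have := (ih.tail hs hM (by omega) hb).2 k (by omega)
        rw [mem_rootSet hM, mul_pow] at this
        rw [this, mul_pow, exp_mid_pow hM, mul_one]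

/-! ### The energy as a sum over binary digits. -/

/-- The sum of `W m` over the positions `m` of the nonzero binary digits of `n`. -/
noncomputable def bitSum (W : ℕ → ℝ) (n : ℕ) : ℝ :=
  if _h : n = 0 then 0 else W (Nat.log 2 n) + bitSum W (n - 2 ^ Nat.log 2 n)
termination_by n
decreasing_by
  have : 0 < 2 ^ Nat.log 2 n := by positivity
  omega

@[simp] theorem bitSum_zero (W : ℕ → ℝ) : bitSum W 0 = 0 := by
  rw [bitSum]
  simp

theorem bitSum_two_pow_add (W : ℕ → ℝ) {m r : ℕ} (hr : r < 2 ^ m) :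
    bitSum W (2 ^ m + r) = W m + bitSum W r := by
  have hlog : Nat.log 2 (2 ^ m + r) = m := by
    rw [Nat.log_eq_iff (Or.inr ⟨by norm_num, by positivity⟩), pow_succ]
    omega
  have hne : 2 ^ m + r ≠ 0 := by positivity
  rw [bitSum, dif_neg hne, hlog, Nat.add_sub_cancel_left]

theorem two_pow_add_induction {P : ℕ → Prop} (zero : P 0)
    (add : ∀ m r, r < 2 ^ m → P r → P (2 ^ m + r)) (n : ℕ) : P n := by
  induction n using Nat.strong_induction_on with
  | _ n ih =>
    rcases Nat.eq_zero_or_pos n with rfl | hn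
    · exact zero
    · have h1 := Nat.pow_log_le_self 2 hn.ne'
      have h2 := Nat.lt_pow_succ_log_self (b := 2) (by norm_num) n
      rw [pow_succ] at h2
      have h3 : 0 < 2 ^ Nat.log 2 n := by positivity
      have := add (Nat.log 2 n) (n - 2 ^ Nat.log 2 n) (by omega) (ih _ (by omega))
      rwa [Nat.add_sub_cancel' h1] at this

theorem midPot_nonneg (s : ℝ) {M : ℕ} (hM : M ≠ 0) : 0 ≤ midPot s M :=
  equiPot_nonneg s (pi_div_two_mul_pos hM) (pi_div_two_mul_lt hM)

theorem bitSum_nonneg {W : ℕ → ℝ} (hW : ∀ m, 0 ≤ W m) (n : ℕ) : 0 ≤ bitSum W n := by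
  induction n using two_pow_add_induction with
  | zero => simp
  | add m r hr ih =>
    rw [bitSum_two_pow_add W hr]
    exact add_nonneg (hW m) ih

/-- Removing the leading binary digit of `n` corresponds to removing the first `2 ^ m` points: they
contribute `midPot s (2 ^ m)`, and the remaining points are again greedy. -/
theorem pot_greedy {s : ℝ} (hs : 0 < s) (n : ℕ) : ∀ b : ℕ → Circle, GreedyUpTo s (n + 1) b →
    pot s b n (b n) = ENNReal.ofReal (bitSum (fun m => midPot s (2 ^ m)) n) := by
  induction n using two_pow_add_induction with
  | zero => simp [pot]
  | add m r hr ih =>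
    intro b hb
    have hM : 2 ^ m ≠ 0 := by positivity
    have hP := rootStructure_two_pow hs m
    obtain ⟨h1, h2⟩ := hP.tail hs hM (j := r + 1) (by omega) hb
    have hbM : GreedyUpTo s (2 ^ m) b := hb.mono (by omega)
    rw [pot_add, pot_eq_sum_rootSet hs hM hbM (hP _ le_rfl b hbM),
      sum_kernel_mid s hM (h2 r (by omega)), bitSum_two_pow_add _ hr,
      ENNReal.ofReal_add (midPot_nonneg s hM)
        (bitSum_nonneg (fun k => midPot_nonneg s (by positivity)) r)]
    congr 1
    exact ih _ h1

theorem energy_succ (s : ℝ) (a : ℕ → Circle) (n : ℕ) :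
    energy s a (n + 1) = energy s a n + 2 * pot s a n (a n) := by
  have hn : n ∉ Finset.range n := Finset.notMem_range_self
  have hd : Disjoint ((Finset.range n).offDiag ∪ {n} ×ˢ Finset.range n)
      (Finset.range n ×ˢ {n}) := by
    rw [Finset.disjoint_left]
    rintro ⟨i, j⟩ h1 h2
    simp only [Finset.mem_union, Finset.mem_offDiag, Finset.mem_product, Finset.mem_range,
      Finset.mem_singleton] at h1 h2
    omega
  have hd' : Disjoint (Finset.range n).offDiag ({n} ×ˢ Finset.range n) := by
    rw [Finset.disjoint_left]
    rintro ⟨i, j⟩ h1 h2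
    simp only [Finset.mem_offDiag, Finset.mem_product, Finset.mem_range,
      Finset.mem_singleton] at h1 h2
    omega
  rw [energy, Finset.range_add_one, Finset.offDiag_insert hn, Finset.sum_union hd,
    Finset.sum_union hd', Finset.sum_product, Finset.sum_product]
  simp only [Finset.sum_singleton]
  rw [energy, add_assoc, two_mul, pot]
  congr 2
  exact Finset.sum_congr rfl fun i _ => kernel_comm s _ _

/-- Twice the sum of `bitSum W` over `0, …, N - 1`. -/
noncomputable def bitEnergy (W : ℕ → ℝ) (N : ℕ) : ℝ := 2 * ∑ n ∈ Finset.range N, bitSum W n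

theorem energy_greedy {s : ℝ} (hs : 0 < s) {a : ℕ → Circle} (ha : IsGreedy s a) (N : ℕ) :
    energy s a N = ENNReal.ofReal (bitEnergy (fun m => midPot s (2 ^ m)) N) := by
  have h0 := bitSum_nonneg (W := fun m => midPot s (2 ^ m)) fun k => midPot_nonneg s (by positivity)
  induction N with
  | zero => simp [energy, bitEnergy]
  | succ n ih =>
    rw [energy_succ, ih, pot_greedy hs n a (ha.greedyUpTo _), bitEnergy, bitEnergy,
      Finset.sum_range_succ, mul_add, ENNReal.ofReal_add
        (mul_nonneg two_pos.le (Finset.sum_nonneg fun i _ => h0 i))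
        (mul_nonneg two_pos.le (h0 n)), ENNReal.ofReal_mul (p := 2) two_pos.le (q := bitSum _ n)]
    simp

/-- The case `r = 2 ^ m` is admitted because only indices below `r` enter the sums; it gives the
doubling recursion for powers of two. -/
theorem bitEnergy_two_pow_add (W : ℕ → ℝ) {m r : ℕ} (hr : r ≤ 2 ^ m) :
    bitEnergy W (2 ^ m + r) = bitEnergy W (2 ^ m) + 2 * (r * W m) + bitEnergy W r := by
  have h : ∑ x ∈ Finset.range r, bitSum W (2 ^ m + x)
      = r * W m + ∑ x ∈ Finset.range r, bitSum W x := by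
    rw [Finset.sum_congr rfl fun x hx =>
      bitSum_two_pow_add W ((Finset.mem_range.1 hx).trans_le hr), Finset.sum_add_distrib,
      Finset.sum_const, Finset.card_range, nsmul_eq_mul]
  rw [bitEnergy, bitEnergy, bitEnergy, Finset.sum_range_add, h]
  ring

/-! ### Digit sums of small weights are negligible. -/

theorem bitSum_sub_mul (V W : ℕ → ℝ) (c : ℝ) (n : ℕ) :
    bitSum (fun m => V m - c * W m) n = bitSum V n - c * bitSum W n := by
  induction n using two_pow_add_induction with
  | zero => simp
  | add m r hr ih =>
    rw [bitSum_two_pow_add _ hr, bitSum_two_pow_add _ hr, bitSum_two_pow_add _ hr, ih]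
    ring

theorem bitEnergy_sub_mul (V W : ℕ → ℝ) (c : ℝ) (N : ℕ) :
    bitEnergy (fun m => V m - c * W m) N = bitEnergy V N - c * bitEnergy W N := by
  simp only [bitEnergy, bitSum_sub_mul, Finset.sum_sub_distrib, ← Finset.mul_sum]
  ring

/-- Superadditivity of `t ^ s` for `s ≥ 1` sums the main terms, and `n` has at most `n` nonzero
digits, each costing `K`. -/
theorem abs_bitSum_le {W : ℕ → ℝ} {s ε K : ℝ} (hs : 1 ≤ s) (hε : 0 ≤ ε) (hK : 0 ≤ K)
    (hW : ∀ m, |W m| ≤ ε * ((2 : ℝ) ^ m) ^ s + K) (n : ℕ) :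
    |bitSum W n| ≤ ε * (n : ℝ) ^ s + K * n := by
  induction n using two_pow_add_induction with
  | zero => simp [Real.zero_rpow (by linarith : s ≠ 0)]
  | add m r hr ih =>
    rw [bitSum_two_pow_add _ hr]
    have h1 : ((2 : ℝ) ^ m) ^ s + (r : ℝ) ^ s ≤ ((2 : ℝ) ^ m + r) ^ s :=
      Real.add_rpow_le_rpow_add (by positivity) (by positivity) hs
    have h2 : (1 : ℝ) ≤ 2 ^ m := one_le_pow₀ (by norm_num)
    push_cast
    calc |W m + bitSum W r| ≤ |W m| + |bitSum W r| := abs_add_le _ _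
      _ ≤ (ε * ((2 : ℝ) ^ m) ^ s + K) + (ε * (r : ℝ) ^ s + K * r) := add_le_add (hW m) ih
      _ ≤ ε * ((2 : ℝ) ^ m + r) ^ s + K * (2 ^ m + r) := by nlinarith

theorem abs_bitEnergy_le {W : ℕ → ℝ} {s ε K : ℝ} (hs : 1 ≤ s) (hε : 0 ≤ ε) (hK : 0 ≤ K)
    (hW : ∀ m, |W m| ≤ ε * ((2 : ℝ) ^ m) ^ s + K) (N : ℕ) :
    |bitEnergy W N| ≤ 2 * (N * (ε * (N : ℝ) ^ s + K * N)) := by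
  rw [bitEnergy, abs_mul, abs_two]
  refine mul_le_mul_of_nonneg_left ((Finset.abs_sum_le_sum_abs _ _).trans ?_) two_pos.le
  rw [← nsmul_eq_mul]
  refine (Finset.sum_le_card_nsmul _ _ (ε * (N : ℝ) ^ s + K * N) fun n hn => ?_).trans_eq
    (by rw [Finset.card_range])
  have hnN : (n : ℝ) ≤ N := by exact_mod_cast (Finset.mem_range.1 hn).le
  refine (abs_bitSum_le hs hε hK hW n).trans ?_
  gcongr

theorem tendsto_natCast_rpow_neg {t : ℝ} (ht : t < 0) :
    Tendsto (fun N : ℕ => (N : ℝ) ^ t) atTop (𝓝 0) := by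
  have := (tendsto_rpow_neg_atTop (neg_pos.2 ht)).comp (tendsto_natCast_atTop_atTop (R := ℝ))
  simpa [Function.comp_def] using this

theorem tendsto_bitEnergy_div {W : ℕ → ℝ} {s : ℝ} (hs : 1 < s)
    (hW : Tendsto (fun m => W m / ((2 : ℝ) ^ m) ^ s) atTop (𝓝 0)) :
    Tendsto (fun N : ℕ => bitEnergy W N / (N : ℝ) ^ (1 + s)) atTop (𝓝 0) := by
  rw [Metric.tendsto_atTop] at hW
  rw [tendsto_zero_iff_abs_tendsto_zero, tendsto_order]
  refine ⟨fun a ha => Eventually.of_forall fun N => ha.trans_le (abs_nonneg _), fun a ha => ?_⟩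
  obtain ⟨m₀, hm₀⟩ := hW (a / 4) (by positivity)
  -- `K` absorbs the finitely many weights not yet in the asymptotic regime; its contribution is of
  -- order `N ^ (1 - s)`, which vanishes because `s > 1`.
  set K := ∑ m ∈ Finset.range m₀, |W m| with hKdef
  have hK : 0 ≤ K := Finset.sum_nonneg fun _ _ => abs_nonneg _
  have hbound : ∀ m, |W m| ≤ a / 4 * ((2 : ℝ) ^ m) ^ s + K := by
    intro m
    have hp : 0 < ((2 : ℝ) ^ m) ^ s := by positivity
    rcases lt_or_ge m m₀ with h | h
    · have : |W m| ≤ K := Finset.single_le_sum (f := fun m => |W m|)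
        (fun _ _ => abs_nonneg _) (Finset.mem_range.2 h)
      nlinarith
    · have := hm₀ m h
      rw [Real.dist_eq, sub_zero, abs_div, abs_of_pos hp, div_lt_iff₀ hp] at this
      linarith
  have hlim : Tendsto (fun N : ℕ => 2 * (a / 4 + K * (N : ℝ) ^ (1 - s))) atTop (𝓝 (a / 2)) := by
    have := ((tendsto_natCast_rpow_neg (by linarith : 1 - s < 0)).const_mul K).const_add (a / 4)
    convert this.const_mul 2 using 2
    ring
  filter_upwards [hlim.eventually (gt_mem_nhds (by linarith : a / 2 < a)),
    eventually_ge_atTop 1] with N hN hN1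
  have hNpos : (0 : ℝ) < N := by exact_mod_cast hN1
  refine lt_of_le_of_lt ?_ hN
  rw [Function.comp_apply, abs_div, abs_of_pos (a := (N : ℝ) ^ (1 + s)) (by positivity), div_le_iff₀ (by positivity)]
  refine (abs_bitEnergy_le hs.le (by positivity) hK hbound N).trans_eq ?_
  rw [Real.rpow_sub hNpos, Real.rpow_add hNpos, Real.rpow_one]
  field_simp

/-! ### Asymptotics of the midpoint potential. -/

/-- The potential at one of `M` equally spaced points of the other ones. -/
noncomputable def rootPot (s : ℝ) (M : ℕ) : ℝ :=
  ∑ k ∈ Finset.range M, (2 * Real.sin (Real.pi * k / M)) ^ (-s)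

theorem sum_range_two_mul (f : ℕ → ℝ) (M : ℕ) :
    ∑ k ∈ Finset.range (2 * M), f k
      = ∑ k ∈ Finset.range M, f (2 * k) + ∑ k ∈ Finset.range M, f (2 * k + 1) := by
  induction M with
  | zero => simp
  | succ M ih =>
    rw [show 2 * (M + 1) = 2 * M + 1 + 1 by ring, Finset.sum_range_succ, Finset.sum_range_succ, ih,
      Finset.sum_range_succ, Finset.sum_range_succ]
    ring

/-- Among `2 * M` equally spaced points, the even ones form the original configuration and the odd
ones are its midpoints. The degenerate term `k = 0` occurs in both `rootPot` sums and cancels. -/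
theorem midPot_eq_sub (s : ℝ) (M : ℕ) : midPot s M = rootPot s (2 * M) - rootPot s M := by
  rw [eq_sub_iff_add_eq', rootPot, rootPot, sum_range_two_mul, midPot, equiPot]
  congr 1
  · refine Finset.sum_congr rfl fun k _ => ?_
    push_cast
    rw [mul_left_comm, mul_div_mul_left _ _ two_ne_zero]
  · refine Finset.sum_congr rfl fun k hk => ?_
    have : (M : ℝ) ≠ 0 := by
      have := Finset.mem_range.1 hk
      exact_mod_cast (by omega : M ≠ 0)
    congr 3
    push_cast
    field_simp
    ring

/-- Folding the circle about a diameter leaves angles up to `π / 2`, where sine is bounded below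
linearly. The antipodal point is counted twice, hence the correction `2 ^ (-s)`. -/
theorem rootPot_two_mul {s : ℝ} (hs : s ≠ 0) {L : ℕ} (hL : L ≠ 0) :
    rootPot s (2 * L)
      = 2 * ∑ k ∈ Finset.range L, (2 * Real.sin (Real.pi * (k + 1) / (2 * L))) ^ (-s)
        - 2 ^ (-s) := by
  have hL' : (L : ℝ) ≠ 0 := by exact_mod_cast hL
  set φ : ℕ → ℝ := fun k => (2 * Real.sin (Real.pi * k / (2 * L))) ^ (-s) with hφ
  -- The point itself drops out through the convention that zero to a nonzero real power is `0`.
  have h0 : φ 0 = 0 := by simp [hφ, Real.zero_rpow (neg_ne_zero.2 hs)]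
  have hLL : φ L = 2 ^ (-s) := by
    have : Real.pi * L / (2 * L) = Real.pi / 2 := by field_simp
    simp [hφ, this]
  have h1 : ∑ k ∈ Finset.range L, φ k = ∑ k ∈ Finset.range L, φ (k + 1) - φ L := by
    have := Finset.sum_range_succ φ L
    rw [Finset.sum_range_succ', h0] at this
    linarith
  have h2 : ∑ k ∈ Finset.range L, φ (L + k) = ∑ k ∈ Finset.range L, φ (k + 1) := by
    rw [← Finset.sum_range_reflect]
    refine Finset.sum_congr rfl fun k hk => ?_
    have hk' := Finset.mem_range.1 hk
    have e : ((L + (L - 1 - k) : ℕ) : ℝ) = 2 * L - (k + 1) := by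
      rw [eq_sub_iff_add_eq]
      exact_mod_cast (by omega : L + (L - 1 - k) + (k + 1) = 2 * L)
    simp only [hφ]
    rw [e, ← Real.sin_pi_sub]
    congr 3
    push_cast
    field_simp
    ring
  have h3 : rootPot s (2 * L) = ∑ k ∈ Finset.range (L + L), φ k := by
    rw [rootPot, two_mul]
    refine Finset.sum_congr rfl fun k _ => ?_
    simp only [hφ]
    push_cast
    rw [two_mul (L : ℝ)]
  rw [h3, Finset.sum_range_add, h1, h2, hLL]
  simp only [hφ]
  push_cast
  ring

/-- The limit of the normalized energies of equally spaced points. -/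
noncomputable def rieszConst (s : ℝ) : ℝ := 2 * (riemannZeta (s : ℂ)).re / (2 * Real.pi) ^ s

theorem hasSum_zeta_re {s : ℝ} (hs : 1 < s) :
    HasSum (fun k : ℕ => ((k : ℝ) + 1) ^ (-s)) (riemannZeta (s : ℂ)).re := by
  have hsum : Summable fun k : ℕ => ((k : ℝ) + 1) ^ (-s) := by
    have := (summable_nat_add_iff 1).2 (Real.summable_nat_rpow.2 (by linarith : -s < -1))
    simpa using this
  have hz := zeta_eq_tsum_one_div_nat_add_one_cpow (s := (s : ℂ)) (by simpa using hs)
  have : riemannZeta (s : ℂ) = ((∑' k : ℕ, ((k : ℝ) + 1) ^ (-s) : ℝ) : ℂ) := by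
    rw [hz, Complex.ofReal_tsum]
    refine tsum_congr fun k => ?_
    rw [Complex.ofReal_cpow (by positivity), one_div, ← Complex.cpow_neg]
    push_cast
    rfl
  rw [this, Complex.ofReal_re]
  exact hsum.hasSum

theorem rieszConst_pos {s : ℝ} (hs : 1 < s) : 0 < rieszConst s := by
  have h := hasSum_zeta_re hs
  have : 0 < (riemannZeta (s : ℂ)).re := by
    rw [← h.tsum_eq]
    exact h.summable.tsum_pos (fun k => by positivity) 0 (by positivity)
  have := Real.pi_pos
  rw [rieszConst]
  positivity

theorem tendsto_mul_sin (x : ℝ) :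
    Tendsto (fun L : ℕ => 2 * (L : ℝ) * (2 * Real.sin (x / (2 * L)))) atTop (𝓝 (2 * x)) := by
  have h1 : Tendsto (fun L : ℕ => x / (2 * (L : ℝ))) atTop (𝓝 0) :=
    ((tendsto_natCast_atTop_atTop (R := ℝ)).const_mul_atTop two_pos).const_div_atTop x
  have h2 := (Real.continuous_sinc.tendsto 0).comp h1
  rw [Real.sinc_zero] at h2
  have h3 := h2.const_mul (2 * x)
  rw [mul_one] at h3
  refine h3.congr' ?_
  filter_upwards [eventually_ge_atTop 1] with L hL
  have hL' : (L : ℝ) ≠ 0 := by exact_mod_cast (by omega : L ≠ 0)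
  rcases eq_or_ne x 0 with rfl | hx
  · simp
  · rw [Function.comp_apply, Real.sinc_of_ne_zero (by positivity)]
    field_simp

/-- Dominated convergence for series: the `k`-th term tends to `(2π(k + 1)) ^ (-s)`, and Jordan's
inequality `sin x ≥ 2x / π` gives the summable bound `(k + 1) ^ (-s)`. -/
theorem tendsto_sum_sin_rpow {s : ℝ} (hs : 1 < s) :
    Tendsto (fun L : ℕ => ∑ k ∈ Finset.range L,
      (2 * (L : ℝ) * (2 * Real.sin (Real.pi * (k + 1) / (2 * L)))) ^ (-s)) atTop
      (𝓝 ((riemannZeta (s : ℂ)).re / (2 * Real.pi) ^ s)) := by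
  have hpi := Real.pi_pos
  have hlim : ∑' k : ℕ, (2 * (Real.pi * ((k : ℝ) + 1))) ^ (-s)
      = (riemannZeta (s : ℂ)).re / (2 * Real.pi) ^ s := by
    rw [← (hasSum_zeta_re hs).tsum_eq, div_eq_inv_mul, ← Real.rpow_neg (by positivity),
      ← tsum_mul_left]
    refine tsum_congr fun k => ?_
    rw [← mul_assoc, Real.mul_rpow (by positivity) (by positivity)]
  rw [← hlim]
  set f : ℕ → ℕ → ℝ := fun L k => if k < L then
    (2 * (L : ℝ) * (2 * Real.sin (Real.pi * (k + 1) / (2 * L)))) ^ (-s) else 0 with hf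
  have hfs : ∀ L : ℕ, ∑' k, f L k = ∑ k ∈ Finset.range L,
      (2 * (L : ℝ) * (2 * Real.sin (Real.pi * (k + 1) / (2 * L)))) ^ (-s) := by
    intro L
    rw [tsum_eq_sum (s := Finset.range L)]
    · exact Finset.sum_congr rfl fun k hk => if_pos (Finset.mem_range.1 hk)
    · intro k hk
      exact if_neg fun h => hk (Finset.mem_range.2 h)
  simp only [← hfs]
  refine tendsto_tsum_of_dominated_convergence (bound := fun k : ℕ => ((k : ℝ) + 1) ^ (-s))
    (hasSum_zeta_re hs).summable ?_ ?_
  · intro k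
    have h := (tendsto_mul_sin (Real.pi * ((k : ℝ) + 1))).rpow_const (p := -s)
      (Or.inl (by positivity))
    refine h.congr' ?_
    filter_upwards [eventually_gt_atTop k] with L hL
    exact (if_pos hL).symm
  · refine Eventually.of_forall fun L k => ?_
    simp only [hf]
    split_ifs with h
    · have hL : (0 : ℝ) < L := by exact_mod_cast (by omega : 0 < L)
      have hkL : (k : ℝ) + 1 ≤ L := by exact_mod_cast h
      have hx : Real.pi * ((k : ℝ) + 1) / (2 * L) ≤ Real.pi / 2 := by
        rw [div_le_div_iff₀ (by positivity) two_pos]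
        nlinarith
      have hsin := Real.mul_le_sin (by positivity) hx
      have hle : (k : ℝ) + 1 ≤ 2 * (L : ℝ) * (2 * Real.sin (Real.pi * (k + 1) / (2 * L))) := by
        calc (k : ℝ) + 1 ≤ 4 * ((k : ℝ) + 1) / 1 * (1 / 2) := by linarith
          _ = 2 * (L : ℝ) * (2 * (2 / Real.pi * (Real.pi * (k + 1) / (2 * L)))) * (1 / 2) := by
            field_simp
            ring
          _ ≤ 2 * (L : ℝ) * (2 * (2 / Real.pi * (Real.pi * (k + 1) / (2 * L)))) :=
            mul_le_of_le_one_right (by positivity) (by norm_num)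
          _ ≤ _ := by gcongr
      rw [Real.norm_of_nonneg (Real.rpow_nonneg (le_trans (by positivity) hle) _)]
      exact Real.rpow_le_rpow_of_nonpos (by positivity) hle (by linarith)
    · rw [norm_zero]
      positivity

theorem tendsto_rootPot_div {s : ℝ} (hs : 1 < s) :
    Tendsto (fun L : ℕ => rootPot s (2 * L) / (2 * (L : ℝ)) ^ s) atTop (𝓝 (rieszConst s)) := by
  have h1 := (tendsto_sum_sin_rpow hs).const_mul 2
  have h2 : Tendsto (fun L : ℕ => (2 : ℝ) ^ (-s) * (2 * (L : ℝ)) ^ (-s)) atTop (𝓝 0) := by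
    have := (tendsto_rpow_neg_atTop (by linarith : 0 < s)).comp
      ((tendsto_natCast_atTop_atTop (R := ℝ)).const_mul_atTop two_pos)
    simpa using this.const_mul ((2 : ℝ) ^ (-s))
  have h3 := h1.sub h2
  rw [sub_zero, ← mul_div_assoc] at h3
  refine h3.congr' ?_
  filter_upwards [eventually_ge_atTop 1] with L hL
  have hL' : (0 : ℝ) < L := by exact_mod_cast hL
  rw [rootPot_two_mul (by linarith) (by omega), div_eq_mul_inv, ← Real.rpow_neg (by positivity),
    sub_mul, mul_assoc, Finset.sum_mul]
  congr 2
  refine Finset.sum_congr rfl fun k hk => ?_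
  have hkL : (k : ℝ) + 1 ≤ L := by exact_mod_cast Finset.mem_range.1 hk
  have hpi := Real.pi_pos
  have hx : Real.pi * ((k : ℝ) + 1) / (2 * L) ≤ Real.pi := by
    rw [div_le_iff₀ (by positivity)]
    nlinarith
  have hsin := Real.sin_nonneg_of_nonneg_of_le_pi (by positivity) hx
  rw [Real.mul_rpow (by positivity) (by positivity), mul_comm]

/-- The leading term of `midPot s (2 ^ m)`, divided by `rieszConst s`. -/
noncomputable def leadPot (s : ℝ) (m : ℕ) : ℝ := (2 ^ s - 1) * ((2 : ℝ) ^ m) ^ s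

theorem tendsto_midPot_sub {s : ℝ} (hs : 1 < s) :
    Tendsto (fun m : ℕ => (midPot s (2 ^ m) - rieszConst s * leadPot s m) / ((2 : ℝ) ^ m) ^ s)
      atTop (𝓝 0) := by
  have h1 : Tendsto (fun m : ℕ => rootPot s (2 ^ (m + 1)) / ((2 : ℝ) ^ (m + 1)) ^ s) atTop
      (𝓝 (rieszConst s)) := by
    refine ((tendsto_rootPot_div hs).comp
      (tendsto_pow_atTop_atTop_of_one_lt (r := 2) (by norm_num))).congr fun m => ?_
    rw [Function.comp_apply, pow_succ' 2, pow_succ' (2 : ℝ)]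
    push_cast
    rfl
  -- Shifting the index turns the limit at `2 ^ (m + 1)` into the limit at `2 ^ m`; the difference
  -- of the two yields the factor `2 ^ s - 1`.
  have h2 := (tendsto_add_atTop_iff_nat
    (f := fun m : ℕ => rootPot s (2 ^ m) / ((2 : ℝ) ^ m) ^ s) 1).1 h1
  have h3 := ((h1.const_mul (2 ^ s)).sub h2).sub_const (rieszConst s * (2 ^ s - 1))
  have e : 2 ^ s * rieszConst s - rieszConst s - rieszConst s * (2 ^ s - 1) = 0 := by ring
  rw [e] at h3
  refine h3.congr fun m => ?_
  have hp : ((2 : ℝ) ^ m) ^ s ≠ 0 := by positivity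
  have hp2 : (2 : ℝ) ^ s ≠ 0 := by positivity
  rw [midPot_eq_sub, ← pow_succ', pow_succ' (2 : ℝ), Real.mul_rpow two_pos.le (by positivity),
    leadPot]
  field_simp

/-! ### The leading term of the energy and its bounds. -/

/-- The leading term of `energy s a N`, divided by `rieszConst s`. -/
noncomputable def leadEnergy (s : ℝ) (N : ℕ) : ℝ := N + bitEnergy (leadPot s) N

theorem leadEnergy_zero (s : ℝ) : leadEnergy s 0 = 0 := by
  simp [leadEnergy, bitEnergy]

/-- The summand `N` in `leadEnergy` makes this formula exact: the doubling recursion for `bitEnergy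
(leadPot s)` starts from `0` at `1`, which leaves a deficit of `2 ^ m`. -/
theorem leadEnergy_two_pow (s : ℝ) (m : ℕ) : leadEnergy s (2 ^ m) = 2 ^ m * ((2 : ℝ) ^ m) ^ s := by
  induction m with
  | zero => simp [leadEnergy, bitEnergy]
  | succ m ih =>
    have h := bitEnergy_two_pow_add (leadPot s) (le_refl (2 ^ m))
    rw [← two_mul, ← pow_succ'] at h
    rw [leadEnergy] at ih
    rw [leadEnergy, h, leadPot, pow_succ' (2 : ℝ), Real.mul_rpow two_pos.le (by positivity)]
    push_cast at ih ⊢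
    rw [pow_succ']
    linear_combination 2 * ih

theorem leadEnergy_two_pow_add (s : ℝ) {m r : ℕ} (hr : r ≤ 2 ^ m) :
    leadEnergy s (2 ^ m + r) = ((2 : ℝ) ^ m) ^ s * (2 * (2 ^ s - 1) * r + 2 ^ m)
      + leadEnergy s r := by
  have h := leadEnergy_two_pow s m
  rw [leadEnergy] at h
  rw [leadEnergy, bitEnergy_two_pow_add _ hr, leadEnergy, leadPot]
  push_cast at h ⊢
  linear_combination h

theorem strictConvexOn_rpow_sub {s : ℝ} (hs : 1 < s) :
    StrictConvexOn ℝ (Set.Icc 0 1) fun t : ℝ => (1 + t) ^ (1 + s) - t ^ (1 + s) := by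
  have hd : ∀ p : ℝ, 1 ≤ p → ∀ t : ℝ, HasDerivAt (fun t : ℝ => (1 + t) ^ p - t ^ p)
      (p * ((1 + t) ^ (p - 1) - t ^ (p - 1))) t := by
    intro p hp t
    have h1 := ((hasDerivAt_id t).const_add 1).rpow_const (p := p) (Or.inr hp)
    have h2 := (hasDerivAt_id t).rpow_const (p := p) (Or.inr hp)
    refine (h1.sub h2).congr_deriv ?_
    rw [one_mul, mul_sub, id]
  have hmono : StrictMonoOn (fun t : ℝ => (1 + t) ^ s - t ^ s) (Set.Icc 0 1) := by
    refine strictMonoOn_of_deriv_pos (convex_Icc 0 1)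
      (fun t _ => (hd s hs.le t).continuousAt.continuousWithinAt) fun t ht => ?_
    rw [interior_Icc] at ht
    rw [(hd s hs.le t).deriv]
    refine mul_pos (by linarith) (sub_pos.2 ?_)
    exact Real.rpow_lt_rpow ht.1.le (by linarith) (by linarith)
  refine StrictMonoOn.strictConvexOn_of_deriv (convex_Icc 0 1)
    (fun t _ => (hd (1 + s) (by linarith) t).continuousAt.continuousWithinAt) ?_
  have e : deriv (fun t : ℝ => (1 + t) ^ (1 + s) - t ^ (1 + s))
      = fun t => (1 + s) * ((1 + t) ^ s - t ^ s) := by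
    funext t
    rw [(hd (1 + s) (by linarith) t).deriv, add_sub_cancel_left]
  rw [e]
  intro x hx y hy hxy
  exact mul_lt_mul_of_pos_left (hmono (interior_subset hx) (interior_subset hy) hxy) (by linarith)

/-- A convex function on `[0, 1]` lies below its chord; here the end values are `1` and `2 ^ (1 + s)
- 1`. -/
theorem one_add_rpow_le {s t : ℝ} (hs : 1 < s) (h0 : 0 ≤ t) (h1 : t ≤ 1) :
    (1 + t) ^ (1 + s) ≤ 1 + 2 * (2 ^ s - 1) * t + t ^ (1 + s) := by
  have h := (strictConvexOn_rpow_sub hs).convexOn.2 (Set.left_mem_Icc.2 zero_le_one)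
    (Set.right_mem_Icc.2 zero_le_one) (sub_nonneg.2 h1) h0 (sub_add_cancel 1 t)
  have hs0 : 1 + s ≠ 0 := by linarith
  simp only [smul_eq_mul, mul_zero, mul_one, zero_add, add_zero, Real.one_rpow,
    Real.zero_rpow hs0, one_add_one_eq_two, sub_zero, Real.rpow_add two_pos 1 s,
    Real.rpow_one] at h
  linarith

/-- The strict chord inequality at `t = 1 / 2`, scaled by `2 ^ (1 + s)`: the case `3 = 2 + 1`. -/
theorem three_rpow_lt {s : ℝ} (hs : 1 < s) :
    (3 : ℝ) ^ (1 + s) < 2 ^ s * (2 * (2 ^ s - 1) + 2) + 1 := by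
  have h := (strictConvexOn_rpow_sub hs).2 (Set.left_mem_Icc.2 zero_le_one)
    (Set.right_mem_Icc.2 zero_le_one) zero_ne_one one_half_pos one_half_pos (add_halves 1)
  have hs0 : 1 + s ≠ 0 := by linarith
  simp only [smul_eq_mul, mul_zero, mul_one, zero_add, add_zero, Real.one_rpow,
    Real.zero_rpow hs0, one_add_one_eq_two, sub_zero] at h
  rw [show (1 + 1 / 2 : ℝ) = 3 / 2 by norm_num, Real.div_rpow (by norm_num) (by norm_num),
    Real.div_rpow (by norm_num) (by norm_num), Real.one_rpow, Real.rpow_add two_pos 1 s,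
    Real.rpow_one] at h
  have hp : (0 : ℝ) < 2 ^ s := by positivity
  field_simp at h
  nlinarith

/-- The chord inequality at `t = r / 2 ^ m`, scaled by `(2 ^ m) ^ (1 + s)`, matches the recursion of
`leadEnergy` term by term. -/
theorem rpow_le_leadEnergy {s : ℝ} (hs : 1 < s) (N : ℕ) :
    (N : ℝ) ^ (1 + s) ≤ leadEnergy s N := by
  induction N using two_pow_add_induction with
  | zero => simp [leadEnergy_zero, Real.zero_rpow (by linarith : 1 + s ≠ 0)]
  | add m r hr ih =>
    rw [leadEnergy_two_pow_add s hr.le]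
    have hM : (0 : ℝ) < 2 ^ m := by positivity
    have hr' : (r : ℝ) ≤ 2 ^ m := by exact_mod_cast hr.le
    have h := mul_le_mul_of_nonneg_left (one_add_rpow_le hs (t := (r : ℝ) / 2 ^ m) (by positivity)
      ((div_le_one hM).2 hr')) (by positivity : 0 ≤ ((2 : ℝ) ^ m) ^ (1 + s))
    rw [← Real.mul_rpow hM.le (by positivity), mul_add, mul_add,
      ← Real.mul_rpow hM.le (by positivity), mul_add, mul_div_cancel₀ _ hM.ne', mul_one,
      mul_one, Real.rpow_add hM 1 s, Real.rpow_one] at h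
    push_cast
    refine h.trans ?_
    have e : (2 : ℝ) ^ m * (2 ^ m) ^ s * (2 * (2 ^ s - 1) * (r / 2 ^ m))
        = (2 ^ m) ^ s * (2 * (2 ^ s - 1) * r) := by
      field_simp
    rw [e]
    linarith

/-- The quotient `leadEnergy s N / N ^ (1 + s)`. -/
noncomputable def leadRatio (s : ℝ) (N : ℕ) : ℝ := leadEnergy s N / (N : ℝ) ^ (1 + s)

theorem one_le_leadRatio {s : ℝ} (hs : 1 < s) {N : ℕ} (hN : N ≠ 0) : 1 ≤ leadRatio s N := by
  have : (0 : ℝ) < N := by exact_mod_cast Nat.pos_of_ne_zero hN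
  rw [leadRatio, one_le_div (by positivity)]
  exact rpow_le_leadEnergy hs N

theorem leadRatio_two_pow (s : ℝ) (m : ℕ) : leadRatio s (2 ^ m) = 1 := by
  rw [leadRatio, leadEnergy_two_pow]
  push_cast
  rw [Real.rpow_add (by positivity), Real.rpow_one]
  exact div_self (by positivity)

theorem one_lt_leadRatio_three {s : ℝ} (hs : 1 < s) : 1 < leadRatio s 3 := by
  have h1 : leadEnergy s 3 = 2 ^ s * (2 * (2 ^ s - 1) + 2) + 1 := by
    have h := leadEnergy_two_pow_add s (m := 1) (r := 1) (by norm_num)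
    have h' := leadEnergy_two_pow s 0
    norm_num at h h'
    rw [h, h']
  rw [leadRatio, one_lt_div (by positivity), h1]
  exact_mod_cast three_rpow_lt hs

theorem one_lt_two_rpow {s : ℝ} (hs : 0 < s) : (1 : ℝ) < 2 ^ s :=
  Real.one_lt_rpow (by norm_num) hs

/-- A crude bound from superadditivity of `t ^ s`, sufficient for the finiteness of `hUpper`. -/
theorem leadRatio_le {s : ℝ} (hs : 1 < s) (N : ℕ) : leadRatio s N ≤ 1 + 2 * (2 ^ s - 1) := by
  have h2 := one_lt_two_rpow (by linarith : 0 < s)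
  rcases Nat.eq_zero_or_pos N with rfl | hN
  · rw [leadRatio, leadEnergy_zero, zero_div]
    linarith
  · have hN0 : (0 : ℝ) < N := by exact_mod_cast hN
    have hN1 : (1 : ℝ) ≤ N := by exact_mod_cast hN
    have hNs : 1 ≤ (N : ℝ) ^ s := Real.one_le_rpow hN1 (by linarith)
    have h := abs_bitEnergy_le (W := leadPot s) (ε := 2 ^ s - 1) (K := 0) hs.le (by linarith) le_rfl
      (fun m => by
        rw [leadPot, abs_of_nonneg (mul_nonneg (by linarith) (by positivity)), add_zero]) N
    have h' := (le_abs_self _).trans h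
    rw [leadRatio, div_le_iff₀ (by positivity), leadEnergy, Real.rpow_add hN0, Real.rpow_one]
    nlinarith

/-! ### The functional `H` and the set `Theta`. -/

theorem H_smul {p : ℕ} (θ : Fin p → ℝ) (hθ : ∀ i, 0 ≤ θ i) {c s : ℝ} (hc : 0 < c) :
    H (fun i => θ i / c) s = H θ s / c ^ (1 + s) := by
  rw [H, H, Finset.sum_div]
  refine Finset.sum_congr rfl fun k _ => ?_
  rw [← Finset.sum_div, Real.div_rpow (hθ k) hc.le, Real.rpow_add hc, Real.rpow_one]
  have : c ^ s ≠ 0 := by positivity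
  field_simp

theorem H_succ {p : ℕ} (θ : Fin (p + 1) → ℝ) (s : ℝ) :
    H θ s = θ 0 ^ s * (2 * (2 ^ s - 1) * (∑ i : Fin p, θ i.succ) + θ 0)
      + H (fun i => θ i.succ) s := by
  rw [H, Fin.sum_univ_succ, Fin.sum_Ioi_zero, H]
  simp only [Fin.sum_Ioi_succ]

theorem sum_two_pow_lt {p : ℕ} (n : Fin p → ℕ) (hn : StrictAnti n) (m : ℕ) (hm : ∀ i, n i < m) :
    ∑ i, 2 ^ n i < 2 ^ m := by
  induction p generalizing m with
  | zero => simp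
  | succ p ih =>
    have h := ih (fun i => n i.succ) (hn.comp_strictMono (Fin.strictMono_succ)) (n 0)
      fun i => hn (Fin.succ_pos i)
    have h0 : 2 ^ (n 0 + 1) ≤ 2 ^ m := Nat.pow_le_pow_right two_pos (hm 0)
    rw [pow_succ] at h0
    rw [Fin.sum_univ_succ]
    omega

/-- Both sides obey the same recursion on removing the largest power, which exceeds the sum of all
the others. -/
theorem H_two_pow {p : ℕ} (n : Fin p → ℕ) (hn : StrictAnti n) (s : ℝ) :
    H (fun i => (2 : ℝ) ^ n i) s = leadEnergy s (∑ i, 2 ^ n i) := by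
  induction p with
  | zero => simp [H, leadEnergy_zero]
  | succ p ih =>
    have hn' : StrictAnti fun i : Fin p => n i.succ := hn.comp_strictMono Fin.strictMono_succ
    have hlt := sum_two_pow_lt _ hn' (n 0) fun i => hn (Fin.succ_pos i)
    rw [H_succ, ih _ hn', Fin.sum_univ_succ, leadEnergy_two_pow_add s hlt.le]
    push_cast
    rfl

theorem sum_two_pow_pos {p : ℕ} (hp : 1 ≤ p) (n : Fin p → ℕ) : 0 < ∑ i, 2 ^ n i :=
  Finset.sum_pos (fun i _ => by positivity) ⟨⟨0, hp⟩, Finset.mem_univ _⟩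

theorem H_div_sum {p : ℕ} (hp : 1 ≤ p) (n : Fin p → ℕ) (hn : StrictAnti n) (s : ℝ) :
    H (fun i => (2 : ℝ) ^ n i / ((∑ j, 2 ^ n j : ℕ) : ℝ)) s = leadRatio s (∑ i, 2 ^ n i) := by
  have hpos : (0 : ℝ) < ((∑ j, 2 ^ n j : ℕ) : ℝ) := by exact_mod_cast sum_two_pow_pos hp n
  rw [H_smul _ (fun i => by positivity) hpos, H_two_pow n hn, leadRatio]

theorem exists_strictAnti_sum_two_pow (N : ℕ) :
    ∃ (p : ℕ) (n : Fin p → ℕ), StrictAnti n ∧ ∑ i, 2 ^ n i = N := by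
  induction N using two_pow_add_induction with
  | zero => exact ⟨0, Fin.elim0, fun i => i.elim0, rfl⟩
  | add m r hr ih =>
    obtain ⟨p, n, hn, rfl⟩ := ih
    have hlt : ∀ i, n i < m := fun i => (Nat.pow_lt_pow_iff_right (a := 2) (by norm_num)).1
      ((Finset.single_le_sum (f := fun i => 2 ^ n i) (fun _ _ => Nat.zero_le _)
        (Finset.mem_univ i)).trans_lt hr)
    refine ⟨p + 1, Fin.cons m n, ?_, by simp [Fin.sum_univ_succ]⟩
    intro i j hij
    induction j using Fin.cases with
    | zero => exact absurd hij (Fin.not_lt_zero i)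
    | succ j =>
      induction i using Fin.cases with
      | zero => simpa using hlt j
      | succ i => simpa using hn (Fin.succ_lt_succ_iff.1 hij)

theorem leadRatio_le_hUpper (s : ℝ) {N : ℕ} (hN : N ≠ 0) : (leadRatio s N : EReal) ≤ hUpper s := by
  obtain ⟨p, n, hn, rfl⟩ := exists_strictAnti_sum_two_pow N
  have hp : 1 ≤ p := by
    by_contra h
    obtain rfl : p = 0 := by omega
    simp at hN
  have hsum : ∀ m, ∑ i, 2 ^ (m + n i) = 2 ^ m * ∑ i, 2 ^ n i := fun m => by
    simp only [pow_add, Finset.mul_sum]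
  rw [← H_div_sum hp n hn]
  -- The integers `2 ^ m * N` have the same proportions for every `m`, so the proportions of `N`
  -- themselves belong to `Theta p`.
  refine le_iSup₂_of_le p hp (le_iSup₂_of_le _ ⟨fun m i => m + n i, ?_, ?_, ?_⟩ le_rfl)
  · exact fun m i j hij => Nat.add_lt_add_left (hn hij) m
  · intro m m' h
    simp only [hsum]
    exact Nat.mul_lt_mul_of_pos_right (Nat.pow_lt_pow_right (by norm_num) h) (sum_two_pow_pos hp n)
  · intro i
    refine tendsto_const_nhds.congr fun m => ?_
    rw [hsum, pow_add]
    push_cast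
    rw [mul_div_mul_left _ _ (by positivity)]

/-- Continuity of `H`. Limits `θ i` may be zero, so `s ≥ 0` is what keeps `t ^ s` continuous there.
-/
theorem tendsto_leadRatio_of_mem_Theta {s : ℝ} (hs : 0 ≤ s) {p : ℕ} (hp : 1 ≤ p) {θ : Fin p → ℝ}
    (hθ : θ ∈ Theta p) :
    ∃ u : ℕ → ℕ, StrictMono u ∧ Tendsto (fun m => leadRatio s (u m)) atTop (𝓝 (H θ s)) := by
  obtain ⟨n, hanti, hmono, hlim⟩ := hθ
  refine ⟨_, hmono, ?_⟩
  simp only [← H_div_sum hp _ (hanti _)]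
  unfold H
  exact tendsto_finsetSum _ fun k _ => ((hlim k).rpow_const (Or.inr hs)).mul
    (((tendsto_finsetSum _ fun j _ => hlim j).const_mul _).add (hlim k))

theorem hUpper_le {s : ℝ} (hs : 1 < s) : hUpper s ≤ ((1 + 2 * (2 ^ s - 1) : ℝ) : EReal) := by
  refine iSup₂_le fun p hp => iSup₂_le fun θ hθ => EReal.coe_le_coe_iff.2 ?_
  obtain ⟨u, -, hu⟩ := tendsto_leadRatio_of_mem_Theta (by linarith : 0 ≤ s) hp hθ
  exact le_of_tendsto' hu fun m => leadRatio_le hs _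

theorem frequently_lt_leadRatio {s : ℝ} (hs : 0 ≤ s) {c : ℝ} (hc : (c : EReal) < hUpper s) :
    ∃ᶠ N in atTop, c < leadRatio s N := by
  simp only [hUpper, hUpperAt, lt_iSup_iff, EReal.coe_lt_coe_iff] at hc
  obtain ⟨p, hp, θ, hθ, hlt⟩ := hc
  obtain ⟨u, hmono, hu⟩ := tendsto_leadRatio_of_mem_Theta hs hp hθ
  exact hmono.tendsto_atTop.frequently (hu.eventually (lt_mem_nhds hlt)).frequently

/-! ### Passage to limsup and liminf. -/

theorem limsup_coe_eq {X : ℕ → ℝ} {L : ℝ} (h1 : ∀ ε > 0, ∀ᶠ N in atTop, X N ≤ L + ε)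
    (h2 : ∀ ε > 0, ∃ᶠ N in atTop, L - ε ≤ X N) :
    limsup (fun N => (X N : EReal)) atTop = L := by
  refine le_antisymm (EReal.le_of_forall_lt_iff_le.1 fun z hz => ?_)
    (EReal.ge_of_forall_gt_iff_ge.1 fun z hz => ?_)
  · rw [EReal.coe_lt_coe_iff] at hz
    refine limsup_le_of_le (h := ?_)
    filter_upwards [h1 (z - L) (by linarith)] with N hN
    exact EReal.coe_le_coe_iff.2 (by linarith)
  · rw [EReal.coe_lt_coe_iff] at hz
    exact le_limsup_of_frequently_le' ((h2 (L - z) (by linarith)).mono fun N hN =>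
      EReal.coe_le_coe_iff.2 (by linarith))

theorem liminf_coe_eq {X : ℕ → ℝ} {L : ℝ} (h1 : ∀ ε > 0, ∀ᶠ N in atTop, L - ε ≤ X N)
    (h2 : ∀ ε > 0, ∃ᶠ N in atTop, X N ≤ L + ε) :
    liminf (fun N => (X N : EReal)) atTop = L := by
  refine le_antisymm (EReal.le_of_forall_lt_iff_le.1 fun z hz => ?_)
    (EReal.ge_of_forall_gt_iff_ge.1 fun z hz => ?_)
  · rw [EReal.coe_lt_coe_iff] at hz
    exact liminf_le_of_frequently_le' ((h2 (z - L) (by linarith)).mono fun N hN =>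
      EReal.coe_le_coe_iff.2 (by linarith))
  · rw [EReal.coe_lt_coe_iff] at hz
    refine le_liminf_of_le (h := ?_)
    filter_upwards [h1 (L - z) (by linarith)] with N hN
    exact EReal.coe_le_coe_iff.2 (by linarith)

theorem bitEnergy_midPot_nonneg (s : ℝ) (N : ℕ) : 0 ≤ bitEnergy (fun m => midPot s (2 ^ m)) N :=
  mul_nonneg two_pos.le (Finset.sum_nonneg fun _ _ =>
    bitSum_nonneg (fun _ => midPot_nonneg s (by positivity)) _)

theorem normalizedEnergy_greedy {s : ℝ} (hs : 0 < s) {a : ℕ → Circle} (ha : IsGreedy s a) {N : ℕ}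
    (hN : N ≠ 0) : normalizedEnergy s a N
      = ((bitEnergy (fun m => midPot s (2 ^ m)) N / (N : ℝ) ^ (1 + s) : ℝ) : EReal) := by
  have hN0 : (0 : ℝ) < N := by exact_mod_cast Nat.pos_of_ne_zero hN
  have h0 := bitEnergy_midPot_nonneg s N
  rw [normalizedEnergy, energy_greedy hs ha, ← ENNReal.ofReal_natCast,
    ENNReal.ofReal_rpow_of_pos hN0, ← ENNReal.ofReal_div_of_pos (by positivity),
    EReal.coe_ennreal_ofReal, max_eq_left (by positivity)]

/-- The weights differ from their leading terms by `o((2 ^ m) ^ s)`, and the extra summand `N` in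
`leadEnergy` contributes only a multiple of `N ^ (-s)`. -/
theorem tendsto_energy_sub {s : ℝ} (hs : 1 < s) :
    Tendsto (fun N : ℕ => bitEnergy (fun m => midPot s (2 ^ m)) N / (N : ℝ) ^ (1 + s)
      - rieszConst s * leadRatio s N) atTop (𝓝 0) := by
  have h1 := tendsto_bitEnergy_div hs (tendsto_midPot_sub hs)
  have h2 := (tendsto_natCast_rpow_neg (by linarith : -s < 0)).const_mul (rieszConst s)
  have h3 := h1.sub h2
  rw [mul_zero, sub_zero] at h3
  refine h3.congr' ?_
  filter_upwards [eventually_ge_atTop 1] with N hN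
  have hN0 : (0 : ℝ) < N := by exact_mod_cast hN
  have hp : (N : ℝ) ^ s ≠ 0 := by positivity
  rw [bitEnergy_sub_mul, leadRatio, leadEnergy, Real.rpow_neg hN0.le, Real.rpow_add hN0,
    Real.rpow_one]
  field_simp
  ring

end GreedyRiesz

theorem theorem4 (s : ℝ) (hs : 1 < s) (a : ℕ → Circle) (ha : GreedyRiesz.IsGreedy s a) :
    limsup (fun N : ℕ => GreedyRiesz.normalizedEnergy s a N) atTop =
      GreedyRiesz.hUpper s *
        ((2 * (riemannZeta (s : ℂ)).re / (2 * Real.pi) ^ s : ℝ) : EReal) ∧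
    liminf (fun N : ℕ => GreedyRiesz.normalizedEnergy s a N) atTop =
      ((2 * (riemannZeta (s : ℂ)).re / (2 * Real.pi) ^ s : ℝ) : EReal) ∧
    1 < GreedyRiesz.hUpper s ∧ GreedyRiesz.hUpper s < ⊤ ∧
    ¬ ∃ l : EReal, Tendsto (fun N : ℕ => GreedyRiesz.normalizedEnergy s a N) atTop (𝓝 l) := by
  have hs0 : 0 < s := by linarith
  change limsup _ atTop = _ * (GreedyRiesz.rieszConst s : EReal) ∧
    liminf _ atTop = (GreedyRiesz.rieszConst s : EReal) ∧ _
  have hC := GreedyRiesz.rieszConst_pos hs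
  set C := GreedyRiesz.rieszConst s
  have hlt : 1 < GreedyRiesz.hUpper s :=
    lt_of_lt_of_le (by exact_mod_cast GreedyRiesz.one_lt_leadRatio_three hs)
      (GreedyRiesz.leadRatio_le_hUpper s (N := 3) (by norm_num))
  have htop : GreedyRiesz.hUpper s < ⊤ :=
    (GreedyRiesz.hUpper_le hs).trans_lt (EReal.coe_lt_top _)
  obtain ⟨h, hh⟩ : ∃ h : ℝ, GreedyRiesz.hUpper s = h :=
    ⟨_, (EReal.coe_toReal htop.ne (((EReal.bot_lt_coe 1).trans hlt).ne')).symm⟩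
  set X : ℕ → ℝ := fun N =>
    GreedyRiesz.bitEnergy (fun m => GreedyRiesz.midPot s (2 ^ m)) N / (N : ℝ) ^ (1 + s) with hX
  have hEX : (fun N : ℕ => GreedyRiesz.normalizedEnergy s a N) =ᶠ[atTop]
      fun N => (X N : EReal) := by
    filter_upwards [eventually_ge_atTop 1] with N hN
    exact GreedyRiesz.normalizedEnergy_greedy hs0 ha (by omega)
  have hclose : ∀ ε > 0, ∀ᶠ N in atTop, |X N - C * GreedyRiesz.leadRatio s N| ≤ ε := fun ε hε => by
    have := (Metric.tendsto_nhds.1 (GreedyRiesz.tendsto_energy_sub hs)) ε hε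
    filter_upwards [this] with N hN
    rw [Real.dist_eq, sub_zero] at hN
    exact hN.le
  have hsup : limsup (fun N : ℕ => GreedyRiesz.normalizedEnergy s a N) atTop
      = GreedyRiesz.hUpper s * (C : EReal) := by
    rw [limsup_congr hEX, hh, ← EReal.coe_mul]
    refine GreedyRiesz.limsup_coe_eq (fun ε hε => ?_) fun ε hε => ?_
    · filter_upwards [hclose ε hε, eventually_ge_atTop 1] with N hN hN1
      have h1 := GreedyRiesz.leadRatio_le_hUpper s (N := N) (by omega)
      rw [hh, EReal.coe_le_coe_iff] at h1
      have := (abs_le.1 hN).2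
      nlinarith
    · have hlt' : ((h - ε / 2 / C : ℝ) : EReal) < GreedyRiesz.hUpper s := by
        rw [hh, EReal.coe_lt_coe_iff]
        have : 0 < ε / 2 / C := by positivity
        linarith
      refine ((GreedyRiesz.frequently_lt_leadRatio hs0.le hlt').and_eventually
        (hclose (ε / 2) (by positivity))).mono fun N hN => ?_
      have h1 := mul_lt_mul_of_pos_left hN.1 hC
      rw [mul_sub, mul_div_cancel₀ _ hC.ne'] at h1
      have := (abs_le.1 hN.2).1
      linarith
  have hinf : liminf (fun N : ℕ => GreedyRiesz.normalizedEnergy s a N) atTop = (C : EReal) := by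
    rw [liminf_congr hEX]
    refine GreedyRiesz.liminf_coe_eq (fun ε hε => ?_) fun ε hε => ?_
    · filter_upwards [hclose ε hε, eventually_ge_atTop 1] with N hN hN1
      have h1 := GreedyRiesz.one_le_leadRatio hs (N := N) (by omega)
      have := (abs_le.1 hN).1
      nlinarith
    · have hpow : Tendsto (fun m : ℕ => 2 ^ m) atTop atTop :=
        tendsto_pow_atTop_atTop_of_one_lt (r := 2) (by norm_num)
      refine hpow.frequently (((hpow.eventually (hclose ε hε)).mono fun m hm => ?_).frequently)
      rw [GreedyRiesz.leadRatio_two_pow] at hm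
      linarith [(abs_le.1 hm).2]
  refine ⟨hsup, hinf, hlt, htop, ?_⟩
  rintro ⟨l, hl⟩
  -- A limit would force `h * C = C`, contrary to `h > 1` and `C > 0`.
  have he := hl.limsup_eq.trans hl.liminf_eq.symm
  rw [hsup, hinf, hh, ← EReal.coe_mul, EReal.coe_eq_coe_iff] at he
  have h1 : 1 < h := by
    rw [hh] at hlt
    exact_mod_cast hlt
  nlinarith
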